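/- **Setting.** Let $\mathcal L$ be a countable first-order language with a binary relation symbol $<$, let $\theta$ be a strongly inaccessible cardinal (uncountable, regular, strong limit), and let $M$ be a $\theta$-like $\mathcal L$-structure: $<$ is interpreted by a linear order, $|M|=\theta$, and every element of $M$ has fewer than $\theta$ predecessors. Let $M$ be expanded to a structure for a language $\mathcal L^S\supseteq\mathcal L$ with Skolem functions: for every $\mathcal L$-formula $\varphi(x_1,\dots,x_n,y)$ there is an $n$-ary function symbol $f$ of $\mathcal L^S$ with $M\models\forall\bar x\,(\exists y\,\varphi(\bar x,y)\to\varphi(\bar x,f(\bar x)))$. Let $M=\bigcup_{i<\theta}M_i$, where $\langle M_i\mid i<\theta\rangle$ is a strictly increasing chain of $\mathcal L^S$-submodels that are elementary for $\mathcal L$, $M_j$ is an end extension of $M_i$ for $i<j$ (every element of $M_j\setminus M_i$ is larger than every element of $M_i$), and $M_\delta=\bigcup_{i<\delta}M_i$ for limit $\delta<\theta$. For $a\in M$ let $F(a)$ be the least $i<\theta$ with $a\in M_i$. **Superlarge sets.** For $X\subseteq M$ let $[X]^r$ be the set of increasing $r$-sequences from $X$, and let $[X]^\mu$, for a cardinal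 $\mu$ in the role of a size, be the set of subsets of $X$ of cardinality $\mu$. Let $r,s\ge 1$. For $f\ge 0$ let $[F]^{r,f}$ be the set of all $f$-tuples $\mathbf x=\langle\langle x_{11},\dots,x_{1r}\rangle,\dots,\langle x_{f1},\dots,x_{fr}\rangle\rangle$ of elements of $[M]^r$ such that $F(x_{ij})=F(x_{il})$ for all $i,j,l$ and $F(x_{11})<F(x_{21})<\dots<F(x_{f1})$; for $A\subseteq M$ let $[F|A]^{r,f}$ be the set of those $\mathbf x\in[F]^{r,f}$ with all $x_{ij}\in A$. For $1\le e\le s$ and $S\subseteq[F]^{r,s}$, in the game $G(S,e)$ players I and II move alternately, $e$ times each, I first. In his $k$-th move I chooses a cardinal $\mu_k<\theta$. In his $k$-th move, $k<e$, II chooses an ordinal $\beta_k<\theta$; in his last move he chooses a sequence $\langle\beta_{e+i}\mid i<\theta\rangle$ of ordinals $<\theta$. II wins if $\beta_1<\beta_2<\dots<\beta_e<\dots<\beta_{e+i}<\cdots$ $(i<\theta)$ and there are sets $X_k\subseteq F^{-1}(\beta_k)$ with $|X_k|=\mu_k$ for $1\le k\le e$, and sets $X_{e+i}\subseteq F^{-1}(\beta_{e+i})$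 for $1\le i<\theta$, such that $\sup\{|X_{e+i}| : 1\le i<\theta\}=\theta$ and $$\prod_{1\le k\le e}[X_k]^r\times\Big[F\,\Big|\bigcup_{1\le i<\theta}X_{e+i}\Big]^{r,\,s-e}\subseteq S$$ (for $s=e$ the second factor is omitted). $S$ is called *$e$-superlarge* if II has a winning strategy in $G(S,e)$. **Sentences of type $\Sigma^*(iv)$.** Let $C^*=\{c_{ij}\mid i,j\ge 1\}$ be new constant symbols indexed by pairs of positive integers. A sentence $\sigma$ of type $\Sigma^*(iv)$ is an $\mathcal L^S(C^*)$-sentence $$\tau(c_{i_1j_1},\dots,c_{i_nj_n})<c_{uv}\ \rightarrow\ \tau(c_{i_1j_1},\dots,c_{i_nj_n})=\tau(c_{i_1j_1},\dots,c_{i_mj_m},c_{i_{m+1}l_{m+1}},\dots,c_{i_nl_n}),$$ where $n\ge 1$, $\tau(v_1,\dots,v_n)$ is a term of $\mathcal L^S$, $u<i_n$, $m\ge 0$ is the least integer with $i_{m+1}>u$, and both sequences of constants to which $\tau$ is applied are strictly increasing in the lexicographic order of their indices. Put $\iota(\sigma)=i_n$. If $i\le s$ and $j\le r$ for all the constants $c_{ij}$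 displayed in $\sigma$, then for $\mathbf a\in[F]^{r,s}$ we write $M\models\sigma(\mathbf a)$ if $\sigma$ holds in $M$ when every $c_{ij}$ is interpreted by $a_{ij}$. **Proposition.** Let $1\le e\le s$ and let $S\subseteq[F]^{r,s}$ be an $e$-superlarge set. Let $\sigma$ be a sentence of type $\Sigma^*(iv)$ such that $i\le s$ and $j\le r$ for all $c_{ij}$ occurring in $\sigma$, and let $\iota(\sigma)=e'\ge e$. Then there is an $e'$-superlarge set $S'\subseteq S$ such that $M\models\sigma(\mathbf a)$ for every $\mathbf a\in S'$. -/

import Mathlib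

open FirstOrder Cardinal

universe u v w v' w'

namespace KeislerModels

/-! ### The model, its Skolem expansion and the elementary end extension chain -/

section Model

/-- A linearly ordered set is `θ`-like if it has cardinality `θ` and each of its elements has fewer
than `θ` predecessors. -/
def IsLike (θ : Cardinal.{u}) (M : Type u) [LinearOrder M] : Prop :=
  #M = θ ∧ ∀ a : M, #(Set.Iio a) < θ

variable {L : FirstOrder.Language.{v, w}} {LS : FirstOrder.Language.{v', w'}}

/-- `M` satisfies the Skolem theory of `L` in the expanded language `LS`: for every `L`-formula
`φ(x₁, …, xₙ, y)` there is an `n`-ary function symbol `f` of `LS` such that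
`M ⊨ ∀ x₁ … xₙ (∃ y φ(x₁, …, xₙ, y) → φ(x₁, …, xₙ, f(x₁, …, xₙ)))`. -/
def HasSkolemFunctions (_ι : L →ᴸ LS) (M : Type u) [L.Structure M] [LS.Structure M] : Prop :=
  ∀ (n : ℕ) (φ : L.BoundedFormula Empty (n + 1)), ∃ f : LS.Functions n, ∀ x : Fin n → M,
    (∃ y : M, φ.Realize default (Fin.snoc x y : Fin (n + 1) → M)) →
      φ.Realize default
        (Fin.snoc x (FirstOrder.Language.Structure.funMap f x) : Fin (n + 1) → M)

/-- `⟨N i | i < θ⟩` is a continuous elementary end extension chain of `LS`-submodels of `M` with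
union `M`. Only the values `N i` with `i < θ` matter. Elementarity is required for the formulas
of `L`; each `N i` is a submodel for the larger language `LS`. -/
structure IsElementaryEndChain (ι : L →ᴸ LS) {M : Type u} [LinearOrder M] [L.Structure M]
    [LS.Structure M] [ι.IsExpansionOn M] (θ : Cardinal.{u})
    (N : Ordinal.{u} → LS.Substructure M) : Prop where
  elementary : ∀ i < θ.ord, (ι.substructureReduct (N i)).IsElementary
  strictMono : ∀ i j, i < j → j < θ.ord → N i < N j
  endExtension : ∀ i j, i < j → j < θ.ord → ∀ a ∈ N i, ∀ b ∈ N j, b ∉ N i → a < b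
  continuous : ∀ i < θ.ord, Order.IsSuccLimit i → ∀ a ∈ N i, ∃ j < i, a ∈ N j
  exhausts : ∀ a : M, ∃ i < θ.ord, a ∈ N i

/-- The rank function `F : M → θ` of a chain: `F a` is the least `i < θ` with `a ∈ N i`. -/
noncomputable def rank {M : Type u} [LS.Structure M] (θ : Cardinal.{u})
    (N : Ordinal.{u} → LS.Substructure M) (a : M) : Ordinal.{u} :=
  sInf {i | i < θ.ord ∧ a ∈ N i}

end Model

/-! ### Superlarge sets -/

section Superlarge

variable {M : Type u} [LinearOrder M]

/-- The set `[F]^{r,s}` of all `s`-tuples of increasing `r`-sequences of elements of `M` such that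
`F` is constant on every row and `F` increases strictly from each row to the next. -/
def rowTuples (F : M → Ordinal.{u}) (r s : ℕ) : Set (Fin s → Fin r → M) :=
  {x | (∀ i, StrictMono (x i)) ∧ (∀ i j l, F (x i j) = F (x i l)) ∧
    ∀ i i' j j', i < i' → F (x i j) < F (x i' j')}

/-- The set `[F|A]^{r,s}` of those tuples in `[F]^{r,s}` all of whose entries are in `A`. -/
def rowTuplesIn (F : M → Ordinal.{u}) (A : Set M) (r s : ℕ) : Set (Fin s → Fin r → M) :=
  {x | x ∈ rowTuples F r s ∧ ∀ i j, x i j ∈ A}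

/-- The product `∏_{i ≤ e} [X i]^r × [F|A]^{r,f}`, `f = s - e`, as a set of `s`-tuples of
`r`-sequences: the first `e` rows are increasing sequences from the respective sets `X i`, and the
remaining rows form an element of `[F|A]^{r,f}`. For `f = 0` only the first factor remains. -/
def rowProduct (F : M → Ordinal.{u}) {r s e : ℕ} (X : Fin e → Set M) (A : Set M) :
    Set (Fin s → Fin r → M) :=
  {x | (∀ (i : Fin s) (h : i.val < e), StrictMono (x i) ∧ ∀ j, x i j ∈ X ⟨i.val, h⟩) ∧
    (fun k : Fin (s - e) => x ⟨e + k.val, by omega⟩) ∈ rowTuplesIn F A r (s - e)}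

/-- The winning condition of the game `G(S, e)` for player II, for a finished play: player I has
played the cardinals `μ 0, …, μ (e - 1)` (that is, `μ₁, …, μ_e`), player II the ordinals
`β 0, …, β (e - 1)` (that is, `β₁, …, β_e`) together with the ordinals `γ i` for `1 ≤ i < θ`
(that is, `β_{e+i}`); the last move of II is the sequence `⟨β_{e+i} | i < θ⟩`, which consists of
`β_e` and of these `γ i`. The ordinals played must be smaller than `θ`. -/
structure PlayerTwoWins (θ : Cardinal.{u}) (F : M → Ordinal.{u}) {r s : ℕ} (e : ℕ)
    (S : Set (Fin s → Fin r → M)) (μ : Fin e → Cardinal.{u}) (β : Fin e → Ordinal.{u})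
    (γ : Ordinal.{u} → Ordinal.{u}) : Prop where
  head_lt : ∀ k, β k < θ.ord
  tail_lt : ∀ i, 1 ≤ i → i < θ.ord → γ i < θ.ord
  head_increasing : StrictMono β
  head_lt_tail : ∀ k i, 1 ≤ i → i < θ.ord → β k < γ i
  tail_increasing : ∀ i j, 1 ≤ i → i < j → j < θ.ord → γ i < γ j
  exists_sets : ∃ (X : Fin e → Set M) (Y : Ordinal.{u} → Set M),
    (∀ k, X k ⊆ F ⁻¹' {β k} ∧ #(X k) = μ k) ∧
    (∀ i, 1 ≤ i → i < θ.ord → Y i ⊆ F ⁻¹' {γ i}) ∧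
    IsLUB {κ : Cardinal.{u} | ∃ i, 1 ≤ i ∧ i < θ.ord ∧ κ = #(Y i)} θ ∧
    rowProduct F X (⋃ i ∈ {i : Ordinal.{u} | 1 ≤ i ∧ i < θ.ord}, Y i) ⊆ S

/-- A strategy of player II in a game with `e` moves of each player. The ordinal played in the
`k`-th move depends on the first `k` cardinals played by I; the ordinals that II adds in the last
move depend on all the cardinals played by I. -/
structure Strategy (e : ℕ) where
  head : (k : Fin e) → (Fin (k.val + 1) → Cardinal.{u}) → Ordinal.{u}
  tail : (Fin e → Cardinal.{u}) → Ordinal.{u} → Ordinal.{u}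

/-- The strategy wins `G(S, e)` for player II, whichever cardinals `< θ` player I chooses. -/
def Strategy.IsWinning {e : ℕ} (str : Strategy.{u} e) (θ : Cardinal.{u}) (F : M → Ordinal.{u})
    {r s : ℕ} (S : Set (Fin s → Fin r → M)) : Prop :=
  ∀ μ : Fin e → Cardinal.{u}, (∀ k, μ k < θ) →
    PlayerTwoWins θ F e S μ (fun k => str.head k (fun q => μ (Fin.castLE k.isLt q))) (str.tail μ)

/-- `S ⊆ [F]^{r,s}` is `e`-superlarge, `1 ≤ e ≤ s`: player II has a winning strategy for
`G(S, e)`. -/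
def IsSuperlarge (θ : Cardinal.{u}) (F : M → Ordinal.{u}) {r s : ℕ} (e : ℕ)
    (S : Set (Fin s → Fin r → M)) : Prop :=
  1 ≤ e ∧ e ≤ s ∧ S ⊆ rowTuples F r s ∧ ∃ str : Strategy.{u} e, str.IsWinning θ F S

end Superlarge

/-! ### The sentences of type `Σ*(iv)` -/

section Sentences

/-- The term `τ(c_{p₁}, …, c_{pₙ})` of `LS(C*)`, where `C* = {c_{ij}}` and the constant symbol
`c_{ij}` is indexed by the pair `(i, j)`. -/
def substConstants {LS : FirstOrder.Language.{v', w'}} {n : ℕ} (τ : LS.Term (Fin n)) (p : Fin n → ℕ × ℕ) :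
    LS[[ℕ × ℕ]].Term (Empty ⊕ Fin 0) :=
  ((LS.lhomWithConstants (ℕ × ℕ)).onTerm τ).subst fun k => (LS.con (p k)).term

/-- The data of a sentence of type `Σ*(iv)`: a term `τ(v₁, …, vₙ)` of `LS` with `n ≥ 1`, a strictly
increasing (in the lexicographic order of the indices) sequence of constants
`c_{i₁j₁}, …, c_{iₙjₙ}`, a constant `c_{uv}` with `u < iₙ`, and numbers `l`. Here `m` is the
number of `k` with `i_k ≤ u`; as the `i_k` do not decrease, `i_k ≤ u` holds exactly for `k ≤ m`.
The constants `c_{i_k j_k}` with `k ≤ m` are kept, those with `k > m` become `c_{i_k l_k}`;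
the resulting sequence has to be strictly increasing too. All indices start from `1`. -/
structure SigmaIV (LS : FirstOrder.Language.{v', w'}) where
  /-- One less than the number of variables. -/
  n : ℕ
  τ : LS.Term (Fin (n + 1))
  i : Fin (n + 1) → ℕ
  j : Fin (n + 1) → ℕ
  u : ℕ
  v : ℕ
  l : Fin (n + 1) → ℕ
  i_pos : ∀ k, 1 ≤ i k
  j_pos : ∀ k, 1 ≤ j k
  u_pos : 1 ≤ u
  v_pos : 1 ≤ v
  l_pos : ∀ k, 1 ≤ l k
  u_lt : u < i (Fin.last n)
  left_increasing : StrictMono fun k => toLex (i k, j k)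
  right_increasing : StrictMono fun k => toLex (i k, if i k ≤ u then j k else l k)

namespace SigmaIV

variable {LS : FirstOrder.Language.{v', w'}} (σ : SigmaIV LS)

/-- `ι(σ) = iₙ`. -/
def iota : ℕ := σ.i (Fin.last σ.n)

/-- The indices of the constants on the left side. -/
def leftIndex (k : Fin (σ.n + 1)) : ℕ × ℕ := (σ.i k, σ.j k)

/-- The indices of the constants on the right side. -/
def rightIndex (k : Fin (σ.n + 1)) : ℕ × ℕ := (σ.i k, if σ.i k ≤ σ.u then σ.j k else σ.l k)

/-- The sentence `τ(c_{i₁j₁}, …, c_{iₙjₙ}) < c_{uv} →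
τ(c_{i₁j₁}, …, c_{iₙjₙ}) = τ(c̄, c_{i_{m+1}l_{m+1}}, …, c_{iₙlₙ})` of `LS(C*)`, where
`c̄ = ⟨c_{i₁j₁}, …, c_{i_m j_m}⟩`. -/
def sentence (lt : LS.Relations 2) : LS[[ℕ × ℕ]].Sentence :=
  (((LS.lhomWithConstants (ℕ × ℕ)).onRelation lt).boundedFormula₂
      (substConstants σ.τ σ.leftIndex) (LS.con (σ.u, σ.v)).term).imp
    ((substConstants σ.τ σ.leftIndex).bdEqual (substConstants σ.τ σ.rightIndex))

/-- Every `c_{ij}` occurring in `σ` has `i ≤ s` and `j ≤ r`. -/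
def InRange (r s : ℕ) : Prop :=
  (∀ k, (σ.leftIndex k).1 ≤ s ∧ (σ.leftIndex k).2 ≤ r) ∧
  (∀ k, (σ.rightIndex k).1 ≤ s ∧ (σ.rightIndex k).2 ≤ r) ∧ σ.u ≤ s ∧ σ.v ≤ r

end SigmaIV

/-- `M ⊨ φ(𝐚)`: the `LS(C*)`-sentence `φ` holds in `M` when `c_{ij}` is interpreted by `a_{ij}` for
`1 ≤ i ≤ s`, `1 ≤ j ≤ r` (rows and columns of `𝐚` are numbered from `0` here); the other constants
are interpreted in an arbitrary way, which makes no difference if they do not occur in `φ`. -/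
def Holds {LS : FirstOrder.Language.{v', w'}} {M : Type u} [LS.Structure M] {r s : ℕ}
    (φ : LS[[ℕ × ℕ]].Sentence) (a : Fin s → Fin r → M) : Prop :=
  ∀ c : ℕ × ℕ → M, (∀ (i : Fin s) (j : Fin r), c (i.val + 1, j.val + 1) = a i j) →
    letI := FirstOrder.Language.constantsOn.structure c
    M ⊨ φ

end Sentences

end KeislerModels

/-! Two facts carry the proof. By `IsSuperlarge.of_le`, an `e`-superlarge set is `e'`-superlarge for
`e ≤ e' ≤ s`: the tail of a winning play contains arbitrarily large sets arbitrarily far out, so one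
of them can answer an additional cardinal of player I, and what follows it is again a tail. It
remains to treat `e = ι(σ)` (`IsSuperlarge.holds`).

There player II follows the given strategy, but replaces each cardinal of player I by one so large
that Erdős–Rado yields homogeneous subsets of the original size. The number of colours has to be
bounded at the time of the move. It is: a colour of a finite subset of row `k` is a function that
sends each assignment of the earlier rows to a value of `τ` in the submodel of row `u`, and
everything here lies in the submodel of the ordinal played last, which has fewer than `θ` elements.

After the play the sets of the rows above `u` are shrunk from the last row downwards
(`exists_rowwise_homogeneous`). If `τ < c_{uv}`, then `τ` lies in the submodel of row `u` by end
extension, so homogeneity applies and `τ` does not change when the constants above row `u` do. The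
tail stays as it was, since `σ` mentions no row beyond `ι(σ)`. -/

namespace KeislerModels

/-! ### The Erdős–Rado theorem below an inaccessible cardinal -/

section ErdosRado

open Classical in
/-- If `X` is large compared to the well-ordered set `W` and to the set of colours, then there are
a point `x` and an injective sequence in `X` indexed by `W` which is end-homogeneous: every term of
the sequence behaves like `x` over the finite sets of earlier terms. -/
theorem exists_endHomogeneous {W X C : Type u} [LinearOrder W] [WellFoundedLT W]
    (hX : #(W × (Finset W → C)) < #X) (c : Finset X → C) :
    ∃ (x : X) (a : W → X), Function.Injective a ∧ ∀ ξ, ∀ t : Finset W, (∀ η ∈ t, η < ξ) →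
      c (insert (a ξ) (t.image a)) = c (insert x (t.image a)) := by
  have hX0 : Nonempty X := by
    rw [← mk_ne_zero_iff]
    exact (zero_le.trans_lt hX).ne'
  -- `P h ξ g z`: the point `z` is a possible `ξ`-th term after the terms `g η`, `η < ξ`, if the
  -- colours are to follow the pattern `h`.
  let P : (Finset W → C) → W → (W → X) → X → Prop := fun h ξ g z =>
    (∀ η < ξ, z ≠ g η) ∧ ∀ t : Finset W, (∀ η ∈ t, η < ξ) → c (insert z (t.image g)) = h t
  have P_congr : ∀ h h' ξ g g', (∀ η < ξ, g η = g' η) →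
      (∀ t : Finset W, (∀ η ∈ t, η < ξ) → h t = h' t) → P h ξ g = P h' ξ g' := by
    intro h h' ξ g g' hg hh
    funext z
    have him : ∀ t : Finset W, (∀ η ∈ t, η < ξ) → t.image g = t.image g' := fun t ht =>
      Finset.image_congr fun η hη => hg η (ht η hη)
    apply propext
    constructor
    · rintro ⟨h1, h2⟩
      exact ⟨fun η hη => hg η hη ▸ h1 η hη, fun t ht => by rw [← him t ht, h2 t ht, hh t ht]⟩
    · rintro ⟨h1, h2⟩
      exact ⟨fun η hη => hg η hη ▸ h1 η hη, fun t ht => by rw [him t ht, h2 t ht, hh t ht]⟩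
  have hex : ∀ x : X, ∃ a : W → X, ∀ ξ,
      a ξ = Classical.epsilon (P (fun t => c (insert x (t.image a))) ξ a) := by
    intro x
    let F : (ξ : W) → ((η : W) → η < ξ → X) → X := fun ξ rec =>
      let g : W → X := fun η => if h : η < ξ then rec η h else x
      Classical.epsilon (P (fun t => c (insert x (t.image g))) ξ g)
    refine ⟨wellFounded_lt.fix F, fun ξ => ?_⟩
    rw [WellFounded.fix_eq]
    have hg : ∀ η < ξ, (fun η => if h : η < ξ then wellFounded_lt.fix F η else x) η =
        wellFounded_lt.fix F η := fun η hη => by simp [hη]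
    refine congrArg Classical.epsilon (P_congr _ _ _ _ _ hg fun t ht => ?_)
    exact congrArg (fun y => c (insert x y)) (Finset.image_congr fun η hη => hg η (ht η hη))
  choose a ha using hex
  -- Each term is chosen by `Classical.epsilon` from a predicate that involves `x` only through its
  -- colour pattern, so the pattern determines the sequence.
  have hdep : ∀ x y, (∀ t : Finset W, c (insert x (t.image (a x))) = c (insert y (t.image (a y)))) →
      a x = a y := by
    intro x y h
    funext ξ
    refine wellFounded_lt.induction (C := fun ξ => a x ξ = a y ξ) ξ fun ξ ih => ?_
    rw [ha x ξ, ha y ξ]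
    exact congrArg Classical.epsilon (P_congr _ _ _ _ _ ih fun t _ => h t)
  -- Otherwise every point of `X` is coded by a place in a sequence and the pattern of that
  -- sequence, which are too few. A point `x` on no sequence is itself a candidate at each stage of
  -- its own sequence, so no choice there is made from an empty set.
  obtain ⟨x, hx⟩ : ∃ x, ∀ y ξ, a y ξ ≠ x := by
    by_contra! hcon
    choose y ξ h using hcon
    have hinj : Function.Injective
        fun x => (ξ x, fun t : Finset W => c (insert (y x) (t.image (a (y x))))) := by
      intro x x' hxx
      rw [Prod.mk.injEq] at hxx
      rw [← h x, ← h x', hdep _ _ fun t => congrFun hxx.2 t, hxx.1]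
    exact (mk_le_of_injective hinj).not_gt hX
  have hsat : ∀ ξ, P (fun t => c (insert x (t.image (a x)))) ξ (a x) (a x ξ) := by
    intro ξ
    have : P (fun t => c (insert x (t.image (a x)))) ξ (a x) x :=
      ⟨fun η _ => (hx x η).symm, fun _ _ => rfl⟩
    rw [ha x ξ]
    exact Classical.epsilon_spec ⟨x, this⟩
  refine ⟨x, a x, fun ξ η h => ?_, fun ξ => (hsat ξ).2⟩
  rcases lt_trichotomy ξ η with hlt | heq | hlt
  · exact ((hsat η).1 ξ hlt h.symm).elim
  · exact heq
  · exact ((hsat ξ).1 η hlt h).elim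

theorem power_lt_of_isInaccessible {θ κ ν : Cardinal.{u}} (hθ : θ.IsInaccessible) (hκ : κ < θ)
    (hν : ν < θ) : κ ^ ν < θ := by
  set m := max (max κ ν) ℵ₀
  have hm : m < θ := max_lt (max_lt hκ hν) hθ.aleph0_lt
  have hm0 : m ≠ 0 := (aleph0_pos.trans_le (le_max_right _ _)).ne'
  calc κ ^ ν ≤ m ^ ν := power_le_power_right ((le_max_left _ _).trans (le_max_left _ _))
    _ ≤ m ^ m := power_le_power_left hm0 ((le_max_right _ _).trans (le_max_left _ _))
    _ = 2 ^ m := power_self_eq (le_max_right _ _)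
    _ < θ := hθ.isStrongLimit.isStrongPrelimit hm

open Classical in
/-- The Erdős–Rado theorem below an inaccessible cardinal `θ`. -/
theorem exists_homogeneous_bound {θ : Cardinal.{u}} (hθ : θ.IsInaccessible) (p : ℕ) :
    ∀ κ < θ, ∀ ν < θ, ∃ μ < θ, ∀ X C : Type u, μ ≤ #X → #C ≤ ν → ∀ c : Finset X → C,
      ∃ H : Set X, #H = κ ∧ ∀ t t' : Finset X, ↑t ⊆ H → ↑t' ⊆ H → t.card = p → t'.card = p →
        c t = c t' := by
  induction p with
  | zero =>
    intro κ hκ ν _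
    refine ⟨κ, hκ, fun X C hX _ c => ?_⟩
    obtain ⟨H, hH⟩ := le_mk_iff_exists_set.1 hX
    refine ⟨H, hH, fun t t' _ _ h h' => ?_⟩
    rw [Finset.card_eq_zero.1 h, Finset.card_eq_zero.1 h']
  | succ p ih =>
    intro κ hκ ν hν
    obtain ⟨μ, hμ, hER⟩ := ih κ hκ ν hν
    -- An infinite `m` has only `m` finite subsets, so `m * ν ^ m` bounds the number of codes in
    -- `exists_endHomogeneous`.
    set m := max μ ℵ₀
    have hm : m < θ := max_lt hμ hθ.aleph0_lt
    have hb : m * ν ^ m < θ :=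
      mul_lt_of_lt hθ.aleph0_lt.le hm (power_lt_of_isInaccessible hθ hν hm)
    refine ⟨Order.succ (m * ν ^ m), hθ.isSuccLimit.succ_lt hb, fun X C hX hC c => ?_⟩
    let W : Type u := m.ord.ToType
    have hW : #W = m := mk_ord_toType m
    have : Infinite W := by
      rw [infinite_iff, hW]
      exact le_max_right _ _
    have hcard : #(W × (Finset W → C)) < #X := by
      refine (Order.succ_le_iff.1 hX).trans_le' ?_
      rw [mk_prod, lift_id, lift_id, ← power_def, mk_finset_of_infinite, hW]
      exact mul_le_mul_right (power_le_power_right hC) _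
    obtain ⟨x, a, ha, hend⟩ := exists_endHomogeneous hcard c
    obtain ⟨H, hH, hhom⟩ := hER W C (hW ▸ le_max_left _ _) hC
      fun t => c (insert x (t.image a))
    -- End-homogeneity lets `x` replace the last term of `t`, which lowers the exponent by one.
    have key : ∀ t : Finset X, ↑t ⊆ a '' H → t.card = p + 1 → ∃ t₀ : Finset W, ↑t₀ ⊆ H ∧
        t₀.card = p ∧ c t = c (insert x (t₀.image a)) := by
      intro t ht hcard
      obtain ⟨t₁, ht₁, rfl⟩ := Finset.subset_set_image_iff.1 ht
      rw [Finset.card_image_of_injective _ ha] at hcard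
      have hne : t₁.Nonempty := Finset.card_pos.1 (by omega)
      refine ⟨t₁.erase (t₁.max' hne), fun η hη => ht₁ (Finset.mem_of_mem_erase hη), ?_, ?_⟩
      · rw [Finset.card_erase_of_mem (t₁.max'_mem hne), hcard]
        rfl
      · rw [← hend (t₁.max' hne) _ fun η hη => t₁.lt_max'_of_mem_erase_max' hne hη,
          ← Finset.image_insert, Finset.insert_erase (t₁.max'_mem hne)]
    refine ⟨a '' H, by rw [mk_image_eq ha, hH], fun t t' ht ht' h h' => ?_⟩
    obtain ⟨t₀, h1, h2, h3⟩ := key t ht h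
    obtain ⟨t₀', h1', h2', h3'⟩ := key t' ht' h'
    rw [h3, h3']
    exact hhom t₀ t₀' h1 h1' h2 h2'

end ErdosRado


/-! ### Simultaneous homogeneity in the rows above a given one -/

section Polarized

variable {I : Type} [LinearOrder I] {M : Type u} [LinearOrder M]

/-- An assignment of elements of `M` to the finitely many indices in `I`, which are arranged in rows:
the rows up to `u` take values in `B`, and each later row `k` is an increasing sequence
from `H k`. -/
structure IsRowwise (row : I → ℕ) (u : ℕ) (B : Set M) (H : ℕ → Set M) (b : I → M) : Prop where
  low : ∀ q, row q ≤ u → b q ∈ B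
  high : ∀ q, u < row q → b q ∈ H (row q)
  increasing : ∀ q q', q < q' → row q = row q' → u < row q → b q < b q'

theorem IsRowwise.mono {row : I → ℕ} {u : ℕ} {B : Set M} {H H' : ℕ → Set M} {b : I → M}
    (hb : IsRowwise row u B H b) (h : ∀ k, H k ⊆ H' k) : IsRowwise row u B H' b :=
  ⟨hb.low, fun q hq => h _ (hb.high q hq), hb.increasing⟩

theorem IsRowwise.mem_of_row_le {row : I → ℕ} {u E : ℕ} {B : ℕ → Set M}
    {H : ℕ → Set M} {b : I → M} (hb : IsRowwise row u (B u) H b)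
    (hB : ∀ k k', u ≤ k → k ≤ k' → k' ≤ E → B k ⊆ B k')
    (hHB : ∀ k, u < k → k ≤ E → H k ⊆ B k) {q : I} {k : ℕ} (huk : u ≤ k) (hk : k ≤ E)
    (hq : row q ≤ k) : b q ∈ B k := by
  rcases le_or_gt (row q) u with h | h
  · exact hB u k le_rfl huk hk (hb.low q h)
  · exact hB _ k h.le hq hk (hHB _ h (hq.trans hk) (hb.high q h))

/-- Two assignments with the same image of a row agree on the row. -/
theorem IsRowwise.eq_on_row [Finite I] {row : I → ℕ} {u k : ℕ} {B : Set M}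
    {H : ℕ → Set M} {b b' : I → M} (hb : IsRowwise row u B H b) (hb' : IsRowwise row u B H b')
    (hk : u < k) (h : b '' {q | row q = k} = b' '' {q | row q = k}) (q : I) (hq : row q = k) :
    b q = b' q := by
  have mono : ∀ {b : I → M}, IsRowwise row u B H b →
      StrictMono fun q : {q | row q = k} => b q := fun hb q q' hqq =>
    hb.increasing q q' hqq (q.2.trans q'.2.symm) (hk.trans_eq q.2.symm)
  rw [Set.image_eq_range, Set.image_eq_range] at h
  exact congrFun ((StrictMono.range_inj (mono hb) (mono hb')).1 h) ⟨q, hq⟩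

open Classical in
/-- If in each row `k` above `u` the sets `X k` are large enough to have homogeneous subsets of size
`μ k`, then a function `val` of assignments can be made independent of these rows by shrinking the
sets `X k` to sets of size `μ k`. -/
theorem exists_rowwise_homogeneous [Fintype I] {V : Type u} [Inhabited V] (row : I → ℕ) (u E : ℕ)
    (huE : u ≤ E) (B : ℕ → Set M)
    (hB : ∀ k k', u ≤ k → k ≤ k' → k' ≤ E → B k ⊆ B k') (X : ℕ → Set M)
    (hXB : ∀ k, u < k → k ≤ E → X k ⊆ B k) (hrow : ∀ q, row q ≤ E) (val : (I → M) → V)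
    (μ : ℕ → Cardinal.{u})
    (hER : ∀ k, u < k → k ≤ E → ∀ c : Finset (X k) → ({q // row q < k} → B (k - 1)) → V,
      ∃ H : Set (X k), #H = μ k ∧ ∀ t t' : Finset (X k), ↑t ⊆ H → ↑t' ⊆ H →
        t.card = Fintype.card {q // row q = k} → t'.card = Fintype.card {q // row q = k} →
          c t = c t') :
    ∃ H : ℕ → Set M, (∀ k, H k ⊆ X k) ∧ (∀ k, u < k → k ≤ E → #(H k) = μ k) ∧
      ∀ b b', IsRowwise row u (B u) H b → IsRowwise row u (B u) H b' →
        (∀ q, row q ≤ u → b q = b' q) → val b = val b' := by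
  -- Descending induction on `k`: rows above `k` are already homogeneous, rows up to `k` are still
  -- the full `X k'`, so that the next colouring can be taken on `X (k + 1)`.
  suffices ∀ d k, k + d = E → u ≤ k → ∃ H : ℕ → Set M, (∀ k, H k ⊆ X k) ∧
      (∀ k', k < k' → k' ≤ E → #(H k') = μ k') ∧ (∀ k' ≤ k, H k' = X k') ∧
      ∀ b b', IsRowwise row u (B u) H b → IsRowwise row u (B u) H b' →
        (∀ q, row q ≤ k → b q = b' q) → val b = val b' by
    obtain ⟨H, h1, h2, -, h3⟩ := this (E - u) u (by omega) le_rfl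
    exact ⟨H, h1, h2, h3⟩
  intro d
  induction d with
  | zero =>
    intro k hk _
    refine ⟨X, fun _ => subset_rfl, fun k' h h' => by omega, fun _ _ => rfl, fun b b' _ _ h => ?_⟩
    rw [funext fun q => h q ((hrow q).trans (by omega))]
  | succ d ih =>
    intro k hk huk
    obtain ⟨H, hHX, hHμ, hHeq, hval⟩ := ih (k + 1) (by omega) (by omega)
    have hHB : ∀ k, u < k → k ≤ E → H k ⊆ B k := fun k h h' => (hHX k).trans (hXB k h h')
    let R (t : Finset (X (k + 1))) (low : {q // row q < k + 1} → B k) (b : I → M) : Prop :=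
      IsRowwise row u (B u) H b ∧ b '' {q | row q = k + 1} = (↑) '' (t : Set (X (k + 1))) ∧
        ∀ q : {q // row q < k + 1}, b q = low q
    -- The rows up to `k + 1` are fixed by `low` and `t`, and `val` no longer depends on the later
    -- ones. So any `b` may be chosen; the default occurs only if there is none.
    let c (t : Finset (X (k + 1))) (low : {q // row q < k + 1} → B k) : V :=
      if h : ∃ b, R t low b then val h.choose else default
    have hc : ∀ t low b, R t low b → c t low = val b := by
      intro t low b hb
      have hex : ∃ b, R t low b := ⟨b, hb⟩
      simp only [c, dif_pos hex]
      have hb' := hex.choose_spec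
      refine hval _ _ hb'.1 hb.1 fun q hq => ?_
      rcases Nat.lt_or_eq_of_le hq with h | h
      · rw [hb'.2.2 ⟨q, h⟩, hb.2.2 ⟨q, h⟩]
      · exact hb'.1.eq_on_row hb.1 (by omega) (hb'.2.1.trans hb.2.1.symm) q h
    obtain ⟨H₀, hH₀, hhom⟩ := hER (k + 1) (by omega) (by omega) c
    have hsub : ∀ k', Function.update H (k + 1) ((↑) '' H₀) k' ⊆ H k' := by
      intro k'
      rcases eq_or_ne k' (k + 1) with rfl | h
      · rw [Function.update_self, hHeq _ le_rfl]
        exact Subtype.coe_image_subset _ _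
      · rw [Function.update_of_ne h]
    refine ⟨Function.update H (k + 1) ((↑) '' H₀), fun k' => (hsub k').trans (hHX k'),
      fun k' h h' => ?_, fun k' h => ?_, fun b b' hb hb' heq => ?_⟩
    · rcases eq_or_ne k' (k + 1) with rfl | hne
      · rw [Function.update_self, mk_image_eq Subtype.val_injective, hH₀]
      · rw [Function.update_of_ne hne]
        exact hHμ k' (by omega) h'
    · rw [Function.update_of_ne (by omega)]
      exact hHeq k' (by omega)
    · have key : ∀ b, IsRowwise row u (B u) (Function.update H (k + 1) ((↑) '' H₀)) b →
          ∃ t : Finset (X (k + 1)), ↑t ⊆ H₀ ∧ t.card = Fintype.card {q // row q = k + 1} ∧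
            ∀ low : {q // row q < k + 1} → B k, (∀ q, b q.1 = low q) → c t low = val b := by
        intro b hb
        have hmem : ∀ q : {q // row q = k + 1}, ∃ x ∈ H₀, x.1 = b q := by
          intro q
          have := hb.high q (by rw [q.2]; omega)
          rw [q.2, Function.update_self] at this
          exact this
        choose f hf hfb using hmem
        have hfinj : Function.Injective f := by
          have : StrictMono fun q : {q // row q = k + 1} => b q := fun q q' hqq =>
            hb.increasing q q' hqq (q.2.trans q'.2.symm) (by rw [q.2]; omega)
          intro q q' hqq
          apply this.injective
          simp only [← hfb, hqq]
        refine ⟨Finset.univ.image f, ?_, ?_, fun low hlow =>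
          hc _ _ _ ⟨hb.mono hsub, ?_, hlow⟩⟩
        · simpa [Set.range_subset_iff] using fun q hq => hf ⟨q, hq⟩
        · rw [Finset.card_image_of_injective _ hfinj, Finset.card_univ]
        · rw [Finset.coe_image, Finset.coe_univ, Set.image_univ, ← Set.range_comp,
            Set.image_eq_range]
          exact congrArg Set.range (funext fun q => (hfb q).symm)
      obtain ⟨t, ht, htc, hv⟩ := key b hb
      obtain ⟨t', ht', htc', hv'⟩ := key b' hb'
      let low : {q // row q < k + 1} → B k := fun q =>
        ⟨b q, (hb.mono hsub).mem_of_row_le hB hHB huk (by omega) (Nat.lt_succ_iff.1 q.2)⟩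
      rw [← hv low fun _ => rfl, ← hv' low fun q => (heq _ (Nat.lt_succ_iff.1 q.2)).symm,
        hhom t t' ht ht' htc htc']

end Polarized


/-! ### The rank function of a chain -/

section Chain

variable {L : FirstOrder.Language.{v, w}} {LS : FirstOrder.Language.{v', w'}} {ι : L →ᴸ LS}
  {M : Type u} [LinearOrder M] [L.Structure M] [LS.Structure M] [ι.IsExpansionOn M]
  {θ : Cardinal.{u}} {N : Ordinal.{u} → LS.Substructure M}

namespace IsElementaryEndChain

theorem mono (hN : IsElementaryEndChain ι θ N) {i j : Ordinal.{u}} (hij : i ≤ j)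
    (hj : j < θ.ord) : N i ≤ N j := by
  rcases hij.eq_or_lt with rfl | h
  · exact le_rfl
  · exact (hN.strictMono i j h hj).le

theorem mem_rank (hN : IsElementaryEndChain ι θ N) (a : M) : a ∈ N (rank θ N a) :=
  (csInf_mem (s := {i | i < θ.ord ∧ a ∈ N i}) (hN.exhausts a)).2

theorem mem_of_lt (hN : IsElementaryEndChain ι θ N) {a b : M} {i : Ordinal.{u}} (hi : i < θ.ord)
    (ha : a ∈ N i) (hba : b < a) : b ∈ N i := by
  by_contra hb
  obtain ⟨j, hj, hbj⟩ := hN.exhausts b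
  rcases le_or_gt j i with h | h
  · exact hb (hN.mono h hi hbj)
  · exact (hN.endExtension i j h hj a ha b hbj hb).not_gt hba

/-- All of `N i` lies below any element of the next submodel outside `N i`. -/
theorem mk_lt (hN : IsElementaryEndChain ι θ N) (hθ : θ.IsInaccessible) (hM : IsLike θ M)
    {i : Ordinal.{u}} (hi : i < θ.ord) : #(N i) < θ := by
  have hi' : Order.succ i < θ.ord := (isSuccLimit_ord hθ.aleph0_lt.le).succ_lt hi
  obtain ⟨b, hb, hbi⟩ := SetLike.exists_of_lt (hN.strictMono i _ (Order.lt_succ i) hi')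
  refine (mk_le_mk_of_subset fun a ha => ?_).trans_lt (hM.2 b)
  exact hN.endExtension i _ (Order.lt_succ i) hi' a ha b hb hbi

end IsElementaryEndChain

end Chain

/-! ### Raising the length of the game -/

section Superlarge

variable {L : FirstOrder.Language.{v, w}} {LS : FirstOrder.Language.{v', w'}} {ι : L →ᴸ LS}
  {M : Type u} [LinearOrder M] [L.Structure M] [LS.Structure M] [ι.IsExpansionOn M]
  {θ : Cardinal.{u}} {N : Ordinal.{u} → LS.Substructure M}

/-- The sets in the tail of a play won by player II are large beyond every stage. -/
theorem exists_large_tail (hθ : θ.IsInaccessible) (hM : IsLike θ M)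
    (hN : IsElementaryEndChain ι θ N) {γ : Ordinal.{u} → Ordinal.{u}} {Y : Ordinal.{u} → Set M}
    (hγ : ∀ i, 1 ≤ i → i < θ.ord → γ i < θ.ord)
    (hmono : ∀ i j, 1 ≤ i → i < j → j < θ.ord → γ i < γ j)
    (hY : ∀ i, 1 ≤ i → i < θ.ord → Y i ⊆ rank θ N ⁻¹' {γ i})
    (hsup : IsLUB {κ : Cardinal.{u} | ∃ i, 1 ≤ i ∧ i < θ.ord ∧ κ = #(Y i)} θ)
    {κ : Cardinal.{u}} (hκ : κ < θ) {j : Ordinal.{u}} (hj1 : 1 ≤ j) (hj : j < θ.ord) :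
    ∃ i, j < i ∧ i < θ.ord ∧ κ < #(Y i) := by
  -- All sets with index at most `j` are contained in `N (γ j)`, so a set larger than this submodel
  -- comes later.
  obtain ⟨_, ⟨i, hi1, hi, rfl⟩, hlt⟩ :=
    (lt_isLUB_iff hsup).1 (max_lt hκ (hN.mk_lt hθ hM (hγ j hj1 hj)))
  refine ⟨i, ?_, hi, (le_max_left _ _).trans_lt hlt⟩
  by_contra! hij
  have hγij : γ i ≤ γ j := by
    rcases hij.eq_or_lt with rfl | h
    · exact le_rfl
    · exact (hmono i j hi1 h hj).le
  refine ((le_max_right _ _).trans_lt hlt).not_ge (mk_le_mk_of_subset fun a ha => ?_)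
  have hrank : rank θ N a = γ i := hY i hi1 hi ha
  exact hN.mono hγij (hγ j hj1 hj) (hrank ▸ hN.mem_rank a)

/-- A play won by player II remains won if a set of the tail is shrunk and moved to the end of
the head. -/
theorem PlayerTwoWins.snoc (hθ : θ.IsInaccessible) (hM : IsLike θ M)
    (hN : IsElementaryEndChain ι θ N) {r s e : ℕ} (he : e < s) {S : Set (Fin s → Fin r → M)}
    {μ : Fin e → Cardinal.{u}} {β : Fin e → Ordinal.{u}} {γ : Ordinal.{u} → Ordinal.{u}}
    (h : PlayerTwoWins θ (rank θ N) e S μ β γ) {κ : Cardinal.{u}} (hκ : κ < θ) :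
    ∃ j, PlayerTwoWins θ (rank θ N) (e + 1) S (Fin.snoc μ κ : Fin (e + 1) → Cardinal.{u})
      (Fin.snoc β (γ j) : Fin (e + 1) → Ordinal.{u}) (fun i => γ (j + i)) := by
  obtain ⟨X, Y, hX, hY, hsup, hS⟩ := h.exists_sets
  have hlim := isSuccLimit_ord hθ.aleph0_lt.le
  have hadd : ∀ {i j : Ordinal.{u}}, i < θ.ord → j < θ.ord → i + j < θ.ord := fun hi hj =>
    Ordinal.isPrincipal_add_ord hθ.aleph0_lt.le hi hj
  have h1 : 1 < θ.ord := by
    simpa using hlim.succ_lt hθ.isRegular.ord_pos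
  obtain ⟨j, hj1, hj, hjκ⟩ := exists_large_tail hθ hM hN h.tail_lt h.tail_increasing hY hsup hκ
    le_rfl h1
  have hlt_add : ∀ {i : Ordinal.{u}}, 1 ≤ i → j < j + i := fun {i} hi =>
    lt_add_of_pos_right j (zero_lt_one.trans_le hi)
  obtain ⟨Z, hZY, hZ⟩ := le_mk_iff_exists_subset.1 hjκ.le
  refine ⟨j, ?_, ?_, ?_, ?_, ?_, ?_⟩
  · refine Fin.lastCases ?_ fun k => ?_
    · simpa using h.tail_lt j hj1.le hj
    · simpa using h.head_lt k
  · exact fun i hi hi' => h.tail_lt _ (hj1.le.trans (hlt_add hi).le) (hadd hj hi')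
  · intro k l
    refine Fin.lastCases ?_ (fun l => ?_) l
    · refine Fin.lastCases (fun h => (lt_irrefl _ h).elim) (fun k _ => ?_) k
      simpa using h.head_lt_tail k j hj1.le hj
    · refine Fin.lastCases (fun h => ?_) (fun k hkl => ?_) k
      · exact ((Fin.castSucc_lt_last l).not_gt h).elim
      · simpa using h.head_increasing (Fin.castSucc_lt_castSucc_iff.1 hkl)
  · intro k i hi hi'
    refine Fin.lastCases ?_ (fun k => ?_) k
    · simpa using h.tail_increasing j _ hj1.le (hlt_add hi) (hadd hj hi')
    · simpa using h.head_lt_tail k _ (hj1.le.trans (hlt_add hi).le) (hadd hj hi')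
  · exact fun i i' hi hii' hi' => h.tail_increasing _ _ (hj1.le.trans (hlt_add hi).le)
      (add_lt_add_right hii' j) (hadd hj hi')
  · refine ⟨Fin.snoc X Z, fun i => Y (j + i), ?_, ?_, ⟨?_, ?_⟩, ?_⟩
    · refine Fin.lastCases ?_ fun k => ?_
      · simpa using ⟨hZY.trans (hY j hj1.le hj), hZ⟩
      · simpa using hX k
    · exact fun i hi hi' => hY _ (hj1.le.trans (hlt_add hi).le) (hadd hj hi')
    · rintro _ ⟨i, hi, hi', rfl⟩
      exact hsup.1 ⟨j + i, hj1.le.trans (hlt_add hi).le, hadd hj hi', rfl⟩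
    · intro c hc
      by_contra! hcθ
      obtain ⟨i, hji, hi, hci⟩ := exists_large_tail hθ hM hN h.tail_lt h.tail_increasing hY hsup
        hcθ hj1.le hj
      -- The new tail is reindexed by `j + i`, so the old index `i` becomes `i - j`.
      refine hci.not_ge (hc ⟨i - j, ?_, (Ordinal.sub_le_self i j).trans_lt hi, ?_⟩)
      · exact Order.one_le_iff_pos.2 (Ordinal.lt_sub.2 (by rwa [add_zero]))
      · simp only [Ordinal.add_sub_cancel_of_le hji.le]
    · rintro x ⟨hhead, ⟨hrow, hrank, hinc⟩, hA⟩
      have hlast := hhead ⟨e, he⟩ (Nat.lt_succ_self e)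
      have hxe : ∀ l, x ⟨e, he⟩ l ∈ Y j := fun l => hZY (by
        have := hlast.2 l
        rwa [show (⟨e, Nat.lt_succ_self e⟩ : Fin (e + 1)) = Fin.last e from rfl,
          Fin.snoc_last] at this)
      have hYrank : ∀ i, 1 ≤ i → i < θ.ord → ∀ a ∈ Y i, rank θ N a = γ i :=
        fun i hi hi' a ha => hY i hi hi' ha
      -- Row `e` is the last head row of the new product but tail row `0` of the old one; the other
      -- tail rows are shifted by one.
      have hcase : ∀ k : Fin (s - e), k.val = 0 ∨ ∃ k' : Fin (s - (e + 1)), k.val = k' + 1 := by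
        intro k
        rcases Nat.eq_zero_or_pos k.val with h | h
        · exact .inl h
        · exact .inr ⟨⟨k - 1, by omega⟩, by simp; omega⟩
      have hx0 : ∀ k : Fin (s - e), k.val = 0 →
          x ⟨e + k, by omega⟩ = x ⟨e, he⟩ := fun k hk => by simp [hk]
      have hx1 : ∀ (k : Fin (s - e)) (k' : Fin (s - (e + 1))), k.val = k' + 1 →
          x ⟨e + k, by omega⟩ = x ⟨e + 1 + k', by omega⟩ := fun k k' hk =>
        congrArg x (Fin.ext (by simp; omega))
      refine hS ⟨fun k hk => ?_, ⟨fun k => ?_, fun k l l' => ?_, fun k k' l l' hkk => ?_⟩,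
        fun k l => ?_⟩
      · have := hhead k (hk.trans (Nat.lt_succ_self e))
        rwa [show (⟨k.val, hk.trans (Nat.lt_succ_self e)⟩ : Fin (e + 1)) =
          Fin.castSucc ⟨k.val, hk⟩ from rfl, Fin.snoc_castSucc] at this
      · rcases hcase k with h | ⟨k', h⟩
        · simpa only [hx0 k h] using hlast.1
        · simpa only [hx1 k k' h] using hrow k'
      · rcases hcase k with h | ⟨k', h⟩
        · simp only [hx0 k h, hYrank j hj1.le hj _ (hxe _)]
        · simpa only [hx1 k k' h] using hrank k' l l'
      · have hk' : k'.val ≠ 0 := fun h => by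
          have : k.val < k'.val := hkk
          omega
        obtain ⟨q', hq'⟩ := (hcase k').resolve_left hk'
        rcases hcase k with h0 | ⟨q, hq⟩
        · simp only [hx0 k h0, hx1 k' q' hq', hYrank j hj1.le hj _ (hxe _)]
          have := hA q' l'
          simp only [Set.mem_iUnion] at this
          obtain ⟨i, ⟨hi, hi'⟩, hmem⟩ := this
          rw [hYrank _ (hj1.le.trans (hlt_add hi).le) (hadd hj hi') _ hmem]
          exact h.tail_increasing j _ hj1.le (hlt_add hi) (hadd hj hi')
        · simp only [hx1 k q hq, hx1 k' q' hq']
          refine hinc q q' l l' ?_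
          have : k.val < k'.val := hkk
          rw [Fin.lt_def]
          omega
      · rcases hcase k with h0 | ⟨q, hq⟩
        · simp only [hx0 k h0, Set.mem_iUnion]
          exact ⟨j, ⟨hj1.le, hj⟩, hxe l⟩
        · have := hA q l
          simp only [Set.mem_iUnion] at this
          obtain ⟨i, ⟨hi, hi'⟩, hmem⟩ := this
          simp only [hx1 k q hq, Set.mem_iUnion]
          exact ⟨j + i, ⟨hj1.le.trans (hlt_add hi).le, hadd hj hi'⟩, hmem⟩

/-- An `e`-superlarge set is `(e + 1)`-superlarge. -/
theorem IsSuperlarge.succ (hθ : θ.IsInaccessible) (hM : IsLike θ M)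
    (hN : IsElementaryEndChain ι θ N) {r s e : ℕ} (he : e < s) {S : Set (Fin s → Fin r → M)}
    (hS : IsSuperlarge θ (rank θ N) e S) : IsSuperlarge θ (rank θ N) (e + 1) S := by
  obtain ⟨-, -, hsub, str, hstr⟩ := hS
  refine ⟨by omega, he, hsub, ?_⟩
  -- The index `j` is chosen from the cardinals alone, all of which are known at the new move. The
  -- conditions stand inside the existential so that `J` is total.
  have hex : ∀ (m : Fin e → Cardinal.{u}) (κ : Cardinal.{u}), ∃ j, (∀ k, m k < θ) → κ < θ →
      PlayerTwoWins θ (rank θ N) (e + 1) S (Fin.snoc m κ : Fin (e + 1) → Cardinal.{u})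
      (Fin.snoc (fun k => str.head k fun q => m (Fin.castLE k.isLt q)) (str.tail m j) :
        Fin (e + 1) → Ordinal.{u}) (fun i => str.tail m (j + i)) := by
    intro m κ
    by_cases h : (∀ k, m k < θ) ∧ κ < θ
    · obtain ⟨j, hj⟩ := (hstr m h.1).snoc hθ hM hN he h.2
      exact ⟨j, fun _ _ => hj⟩
    · exact ⟨0, fun h1 h2 => (h ⟨h1, h2⟩).elim⟩
  choose J hJ using hex
  refine ⟨⟨fun k m => if h : k.val < e then str.head ⟨k.val, h⟩ m else
    str.tail (fun q => m (q.castLE (by omega))) (J (fun q => m (q.castLE (by omega)))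
      (m (Fin.last k))), fun m i => str.tail (Fin.init m) (J (Fin.init m) (m (Fin.last e)) + i)⟩, fun μ hμ => ?_⟩
  have := hJ (Fin.init μ) (μ (Fin.last e)) (fun k => hμ _) (hμ _)
  rw [Fin.snoc_init_self] at this
  convert this using 1
  funext k
  refine Fin.lastCases ?_ (fun k => ?_) k
  · rw [Fin.snoc_last]
    exact dif_neg (by simp)
  · rw [Fin.snoc_castSucc]
    exact dif_pos k.isLt

theorem IsSuperlarge.of_le (hθ : θ.IsInaccessible) (hM : IsLike θ M)
    (hN : IsElementaryEndChain ι θ N) {r s e e' : ℕ} (he : e ≤ e') (he' : e' ≤ s)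
    {S : Set (Fin s → Fin r → M)} (hS : IsSuperlarge θ (rank θ N) e S) :
    IsSuperlarge θ (rank θ N) e' S := by
  induction e', he using Nat.le_induction with
  | base => exact hS
  | succ k _ ih => exact (ih (by omega)).succ hθ hM hN he'

end Superlarge


/-! ### Sentences of type `Σ*(iv)` hold on a superlarge set -/

section Sentences

variable {L : FirstOrder.Language.{v, w}} {LS : FirstOrder.Language.{v', w'}} {ι : L →ᴸ LS}
  {M : Type u} [LinearOrder M] [L.Structure M] [LS.Structure M] [ι.IsExpansionOn M]

theorem realize_substConstants {M : Type u} [LS.Structure M] {n : ℕ} (τ : LS.Term (Fin n)) (p : Fin n → ℕ × ℕ)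
    (c : ℕ × ℕ → M) (v : Empty ⊕ Fin 0 → M) :
    letI := FirstOrder.Language.constantsOn.structure c
    (substConstants τ p).realize v = τ.realize fun k => c (p k) := by
  let := FirstOrder.Language.constantsOn.structure c
  rw [substConstants, FirstOrder.Language.Term.realize_subst,
    FirstOrder.Language.LHom.realize_onTerm]
  exact congrArg τ.realize (funext fun k => FirstOrder.Language.Term.realize_constants)

theorem SigmaIV.holds_iff (σ : SigmaIV LS) {lt : L.Relations 2}
    (hlt : ∀ a b : M, FirstOrder.Language.Structure.RelMap lt ![a, b] ↔ a < b) {r s : ℕ}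
    (a : Fin s → Fin r → M) :
    Holds (σ.sentence (ι.onRelation lt)) a ↔
      ∀ c : ℕ × ℕ → M, (∀ (i : Fin s) (j : Fin r), c (i.val + 1, j.val + 1) = a i j) →
        (σ.τ.realize fun k => c (σ.leftIndex k)) < c (σ.u, σ.v) →
          (σ.τ.realize fun k => c (σ.leftIndex k)) = σ.τ.realize fun k => c (σ.rightIndex k) := by
  refine forall_congr' fun c => forall_congr' fun _ => ?_
  let := FirstOrder.Language.constantsOn.structure c
  have hcon : ∀ v : Empty ⊕ Fin 0 → M, (LS.con (σ.u, σ.v)).term.realize v = c (σ.u, σ.v) :=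
    fun v => FirstOrder.Language.Term.realize_constants
  rw [FirstOrder.Language.Sentence.Realize, SigmaIV.sentence, FirstOrder.Language.Formula.Realize,
    FirstOrder.Language.BoundedFormula.realize_imp,
    FirstOrder.Language.BoundedFormula.realize_rel₂,
    FirstOrder.Language.BoundedFormula.realize_bdEqual, realize_substConstants,
    realize_substConstants, hcon, FirstOrder.Language.LHom.map_onRelation,
    FirstOrder.Language.LHom.map_onRelation, hlt]

end Sentences

/-! ### Strategies that alter the cardinals played by player I -/

section Strategies

/-- The sequence of cardinals obtained from `μ` by replacing its terms one after another, each
depending on the earlier results. -/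
noncomputable def modifyCardinals (G : (k : ℕ) → ((q : ℕ) → q < k → Cardinal.{u}) → Cardinal.{u} →
    Cardinal.{u}) (μ : ℕ → Cardinal.{u}) (k : ℕ) : Cardinal.{u} :=
  G k (fun q _ => modifyCardinals G μ q) (μ k)

/-- This makes the modified strategy legal: an altered cardinal depends on no later move of player
I. -/
theorem modifyCardinals_congr (G : (k : ℕ) → ((q : ℕ) → q < k → Cardinal.{u}) → Cardinal.{u} →
    Cardinal.{u}) {μ μ' : ℕ → Cardinal.{u}} {k : ℕ} (h : ∀ q ≤ k, μ q = μ' q) :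
    modifyCardinals G μ k = modifyCardinals G μ' k := by
  induction k using Nat.strong_induction_on with
  | _ k ih =>
    rw [modifyCardinals, modifyCardinals, h k le_rfl]
    congr 1
    funext q hq
    exact ih q hq fun q' hq' => h q' (hq'.trans hq.le)

/-- Extension of a finite sequence of cardinals by `0`. -/
noncomputable def extendCardinals {n : ℕ} (μ : Fin n → Cardinal.{u}) (k : ℕ) : Cardinal.{u} :=
  if h : k < n then μ ⟨k, h⟩ else 0

/-- The ordinal played by a strategy just before move `k`, if player I has played `prev`; it is `0`
if there is no such move. -/
noncomputable def Strategy.lastOrdinal {e : ℕ} (str : Strategy.{u} e) :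
    (k : ℕ) → ((q : ℕ) → q < k → Cardinal.{u}) → Ordinal.{u}
  | 0, _ => 0
  | k + 1, prev => if h : k < e then str.head ⟨k, h⟩ fun q => prev q q.isLt else 0

/-- The strategy that follows `str`, with the cardinals played by player I modified by `G`. -/
noncomputable def Strategy.modify {e : ℕ} (str : Strategy.{u} e) (G : (k : ℕ) →
    ((q : ℕ) → q < k → Cardinal.{u}) → Cardinal.{u} → Cardinal.{u}) : Strategy.{u} e where
  head k μ := str.head k fun q => modifyCardinals G (extendCardinals μ) q
  tail μ := str.tail fun q => modifyCardinals G (extendCardinals μ) q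

end Strategies

/-! ### The winning strategy for the tuples satisfying the sentence -/

section Main

variable {L : FirstOrder.Language.{v, w}} {LS : FirstOrder.Language.{v', w'}} {ι : L →ᴸ LS}
  {M : Type u} [LinearOrder M] [L.Structure M] [LS.Structure M] [ι.IsExpansionOn M]
  {θ : Cardinal.{u}} {N : Ordinal.{u} → LS.Substructure M}

/-- An upper bound for the number of colours needed in move `k`, if player II played `β` before. -/
noncomputable def colourBound (N : Ordinal.{u} → LS.Substructure M) {I : Type} (row : I → ℕ)
    (k : ℕ) (β : Ordinal.{u}) : Cardinal.{u} :=
  #(({q // row q < k + 1} → N β) → Option (N β))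

/-- Only finitely many constants occur and `N β` has fewer than `θ` elements, so the bound is built
by powers below an inaccessible cardinal. -/
theorem colourBound_lt (hθ : θ.IsInaccessible) (hM : IsLike θ M)
    (hN : IsElementaryEndChain ι θ N) {I : Type} [Finite I] (row : I → ℕ) (k : ℕ)
    {β : Ordinal.{u}} (hβ : β < θ.ord) : colourBound N row k β < θ := by
  have hNβ := hN.mk_lt hθ hM hβ
  rw [colourBound, mk_arrow, lift_id, lift_id, mk_option, mk_arrow, lift_uzero]
  refine power_lt_of_isInaccessible hθ
    (add_lt_of_lt hθ.aleph0_lt.le hNβ (one_lt_aleph0.trans hθ.aleph0_lt))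
    (power_lt_of_isInaccessible hθ hNβ ?_)
  exact (lift_lt_aleph0.2 (lt_aleph0_of_finite _)).trans hθ.aleph0_lt

/-- For each move `k`, each ordinal `β` played before and each cardinal `m` played by player I there
is a cardinal that guarantees homogeneous subsets of size `m`. -/
theorem exists_move_bound (hθ : θ.IsInaccessible) (hM : IsLike θ M)
    (hN : IsElementaryEndChain ι θ N) {I : Type} [Fintype I] (row : I → ℕ) :
    ∃ Φ : ℕ → Ordinal.{u} → Cardinal.{u} → Cardinal.{u}, (∀ k β m, Φ k β m < θ) ∧
      ∀ k, ∀ β < θ.ord, ∀ m < θ, ∀ X C : Type u, Φ k β m ≤ #X → #C ≤ colourBound N row k β →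
        ∀ c : Finset X → C, ∃ H : Set X, #H = m ∧ ∀ t t' : Finset X, ↑t ⊆ H → ↑t' ⊆ H →
          t.card = Fintype.card {q // row q = k + 1} →
          t'.card = Fintype.card {q // row q = k + 1} → c t = c t' := by
  have (k : ℕ) (β : Ordinal.{u}) (m : Cardinal.{u}) : ∃ μ < θ, β < θ.ord → m < θ →
      ∀ X C : Type u, μ ≤ #X → #C ≤ colourBound N row k β →
        ∀ c : Finset X → C, ∃ H : Set X, #H = m ∧ ∀ t t' : Finset X, ↑t ⊆ H → ↑t' ⊆ H →
          t.card = Fintype.card {q // row q = k + 1} →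
          t'.card = Fintype.card {q // row q = k + 1} → c t = c t' := by
    by_cases h : β < θ.ord ∧ m < θ
    · obtain ⟨μ, hμ, hμ'⟩ := exists_homogeneous_bound hθ (Fintype.card {q // row q = k + 1}) m h.2
        _ (colourBound_lt hθ hM hN row k h.1)
      exact ⟨μ, hμ, fun _ _ => hμ'⟩
    · exact ⟨0, hθ.pos, fun h1 h2 => (h ⟨h1, h2⟩).elim⟩
  choose Φ hΦ hΦ' using this
  exact ⟨Φ, hΦ, fun k β hβ m hm => hΦ' k β m hβ hm⟩

/-- The sets of a play that is won by player II with sufficiently large cardinals can be shrunk to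
sets of prescribed sizes on which `σ` holds. -/
theorem SigmaIV.exists_shrink (hN : IsElementaryEndChain ι θ N) {lt : L.Relations 2}
    (hlt : ∀ a b : M, FirstOrder.Language.Structure.RelMap lt ![a, b] ↔ a < b) {r s : ℕ}
    (σ : SigmaIV LS) (hσ : σ.InRange r s) {β : ℕ → Ordinal.{u}} {X : ℕ → Set M}
    {m : ℕ → Cardinal.{u}} (hβθ : ∀ k < σ.iota, β k < θ.ord)
    (hβ : ∀ k k', k < k' → k' < σ.iota → β k < β k')
    (hX : ∀ k < σ.iota, X k ⊆ rank θ N ⁻¹' {β k})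
    (hm : ∀ k < σ.iota, m k ≤ #(X k))
    (hER : ∀ k, k + 1 < σ.iota → ∀ C : Type u, #C ≤ colourBound N σ.i (k + 1) (β k) →
      ∀ c : Finset (X (k + 1)) → C, ∃ H : Set (X (k + 1)), #H = m (k + 1) ∧
        ∀ t t' : Finset (X (k + 1)), ↑t ⊆ H → ↑t' ⊆ H →
          t.card = Fintype.card {q // σ.i q = k + 1 + 1} →
          t'.card = Fintype.card {q // σ.i q = k + 1 + 1} → c t = c t') :
    ∃ H : ℕ → Set M, (∀ k < σ.iota, H k ⊆ X k ∧ #(H k) = m k) ∧ ∀ a : Fin s → Fin r → M,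
      (∀ k : Fin s, k.val < σ.iota → StrictMono (a k) ∧ ∀ j, a k j ∈ H k) →
        Holds (σ.sentence (ι.onRelation lt)) a := by
  classical
  have hu := σ.u_pos
  have hue : σ.u < σ.iota := σ.u_lt
  have hrow : ∀ q, σ.i q ≤ σ.iota := fun q => by
    rcases (Fin.le_last q).eq_or_lt with h | h
    · exact (congrArg σ.i h).le
    · rcases Prod.Lex.lt_iff.1 (σ.left_increasing h) with h | h
      · exact h.le
      · exact h.1.le
  have hmono : ∀ k k', k ≤ k' → k' < σ.iota → N (β k) ≤ N (β k') := by
    intro k k' hk hk'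
    rcases hk.eq_or_lt with rfl | h
    · exact le_rfl
    · exact hN.mono (hβ k k' h hk').le (hβθ k' hk')
  have hXN : ∀ k < σ.iota, X k ⊆ N (β k) := fun k hk a ha => by
    have hrank : rank θ N a = β k := hX k hk ha
    exact hrank ▸ hN.mem_rank a
  -- Rows count from `1` and moves from `0`, so `β (σ.u - 1)` belongs to row `u`. Values outside its
  -- submodel share the colour `none`.
  let val (b : Fin (σ.n + 1) → M) : Option (N (β (σ.u - 1))) :=
    if h : σ.τ.realize b ∈ N (β (σ.u - 1)) then some ⟨_, h⟩ else none
  obtain ⟨H, hHX, hHm, hhom⟩ := exists_rowwise_homogeneous σ.i σ.u σ.iota hue.le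
    (fun k => N (β (k - 1))) (fun k k' hk hkk hk' => hmono _ _ (by omega) (by omega))
    (fun k => X (k - 1)) (fun k hk hk' => hXN _ (by omega)) hrow val (fun k => m (k - 1)) (by
      intro k hk hke c
      -- As `k > u ≥ 1`, there is a move before that of row `k`, and its submodel contains the one
      -- of row `u`; thus the colours inject into those counted by `colourBound`.
      obtain ⟨k, rfl⟩ : ∃ k', k = k' + 2 := ⟨k - 2, by omega⟩
      refine hER k hke _ ?_ c
      have hle : N (β (σ.u - 1)) ≤ N (β k) := hmono _ _ (by omega) (by omega)
      refine mk_le_of_injective (f := fun c x => (c x).map (Set.inclusion hle)) fun c c' h => ?_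
      funext x
      exact Option.map_injective (Set.inclusion_injective hle) (congrFun h x))
  have hlow : ∀ k, ∃ Z ⊆ X k, k < σ.iota → #Z = m k := fun k => by
    by_cases hk : k < σ.iota
    · obtain ⟨Z, hZ, hZm⟩ := le_mk_iff_exists_subset.1 (hm k hk)
      exact ⟨Z, hZ, fun _ => hZm⟩
    · exact ⟨∅, Set.empty_subset _, fun h => (hk h).elim⟩
  choose Z hZX hZm using hlow
  -- `H' k` serves row `k + 1`. Rows up to `u` need no homogeneity and are only cut to size.
  let H' (k : ℕ) : Set M := if σ.u ≤ k then H (k + 1) else Z k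
  have hH'X : ∀ k, H' k ⊆ X k := fun k => by
    by_cases hk : σ.u ≤ k
    · simpa only [H', if_pos hk, Nat.add_sub_cancel] using hHX (k + 1)
    · simpa only [H', if_neg hk] using hZX k
  refine ⟨H', fun k hk => ⟨hH'X k, ?_⟩, fun a ha => (σ.holds_iff hlt a).2 fun c hc hlt => ?_⟩
  · by_cases hk' : σ.u ≤ k
    · simpa only [H', if_pos hk', Nat.add_sub_cancel] using hHm (k + 1) (by omega) (by omega)
    · simpa only [H', if_neg hk'] using hZm k hk
  · have hca : ∀ i j (hi : 1 ≤ i ∧ i ≤ s) (hj : 1 ≤ j ∧ j ≤ r),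
        c (i, j) = a ⟨i - 1, by omega⟩ ⟨j - 1, by omega⟩ := by
      intro i j hi hj
      rw [← hc]
      simp only [Nat.sub_add_cancel hi.1, Nat.sub_add_cancel hj.1]
    have hcH : ∀ i j, 1 ≤ i ∧ i ≤ s → 1 ≤ j ∧ j ≤ r → i ≤ σ.iota → c (i, j) ∈ H' (i - 1) := by
      intro i j hi hj hie
      rw [hca i j hi hj]
      exact (ha ⟨i - 1, by omega⟩ (by simp only; omega)).2 _
    have hrowwise : ∀ p : Fin (σ.n + 1) → ℕ, (∀ q, 1 ≤ p q ∧ p q ≤ r) →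
        StrictMono (fun q => toLex (σ.i q, p q)) →
          IsRowwise σ.i σ.u (N (β (σ.u - 1)) : Set M) H fun q => c (σ.i q, p q) := by
      intro p hp hpm
      have his : ∀ q, 1 ≤ σ.i q ∧ σ.i q ≤ s := fun q => ⟨σ.i_pos q, (hσ.1 q).1⟩
      refine ⟨fun q hq => ?_, fun q hq => ?_, fun q q' hqq hi _ => ?_⟩
      · refine hmono (σ.i q - 1) _ (by omega) (by omega) ?_
        exact hXN _ (by have := his q; omega) (hH'X _ (hcH _ _ (his q) (hp q) (hrow q)))
      · have := hcH _ _ (his q) (hp q) (hrow q)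
        simp only [H', if_pos (show σ.u ≤ σ.i q - 1 by omega)] at this
        rwa [Nat.sub_add_cancel (his q).1] at this
      · have hpq : p q < p q' := by
          rcases Prod.Lex.lt_iff.1 (hpm hqq) with h | h
          · exact (h.ne hi).elim
          · exact h.2
        simp only [← hi]
        rw [hca _ _ (his q) (hp q), hca _ _ (his q) (hp q')]
        refine (ha ⟨σ.i q - 1, by have := his q; omega⟩ ?_).1 ?_
        · have h1 := his q
          have h2 := hrow q
          simp only
          omega
        · have := hp q
          rw [Fin.mk_lt_mk]
          omega
    have hval := hhom _ _
      (hrowwise σ.j (fun q => ⟨σ.j_pos q, (hσ.1 q).2⟩) σ.left_increasing)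
      (hrowwise (fun q => if σ.i q ≤ σ.u then σ.j q else σ.l q) (fun q => ⟨by
        have h1 := σ.j_pos q
        have h2 := σ.l_pos q
        split_ifs <;> assumption, (hσ.2.1 q).2⟩) σ.right_increasing)
      (fun q hq => by simp only [if_pos hq])
    have hmem : (σ.τ.realize fun k => c (σ.leftIndex k)) ∈ N (β (σ.u - 1)) :=
      hN.mem_of_lt (hβθ _ (by omega)) (hXN _ (by omega) (hH'X _ (hcH σ.u σ.v ⟨hu, hσ.2.2.1⟩
        ⟨σ.v_pos, hσ.2.2.2⟩ hue.le))) hlt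
    have hmem' : (σ.τ.realize fun q => c (σ.i q, σ.j q)) ∈ N (β (σ.u - 1)) := hmem
    -- The left value is in the submodel, so its colour is not `none`; equal colours put the right
    -- value there too and make both equal.
    simp only [val, dif_pos hmem'] at hval
    split_ifs at hval
    exact congrArg Subtype.val (Option.some.inj hval)

/-- Player II answers the enlarged cardinals as `str` does; the sets won are then shrunk to the
sizes really asked for. The ordinals played are unaffected by the shrinking. -/
theorem IsSuperlarge.holds (hθ : θ.IsInaccessible) (hM : IsLike θ M)
    (hN : IsElementaryEndChain ι θ N) {lt : L.Relations 2}
    (hlt : ∀ a b : M, FirstOrder.Language.Structure.RelMap lt ![a, b] ↔ a < b) {r s : ℕ}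
    {S : Set (Fin s → Fin r → M)} (σ : SigmaIV LS) (hσ : σ.InRange r s)
    (hS : IsSuperlarge θ (rank θ N) σ.iota S) :
    IsSuperlarge θ (rank θ N) σ.iota {a ∈ S | Holds (σ.sentence (ι.onRelation lt)) a} := by
  obtain ⟨h1, hs, hsub, str, hstr⟩ := hS
  refine ⟨h1, hs, fun a ha => hsub ha.1, ?_⟩
  obtain ⟨Φ, hΦθ, hΦ⟩ := exists_move_bound hθ hM hN σ.i
  let G (k : ℕ) (prev : (q : ℕ) → q < k → Cardinal.{u}) (m : Cardinal.{u}) : Cardinal.{u} :=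
    Φ k (str.lastOrdinal k prev) m
  refine ⟨str.modify G, fun μ hμ => ?_⟩
  let f : ℕ → Cardinal.{u} := extendCardinals μ
  let μ' : Fin σ.iota → Cardinal.{u} := fun q => modifyCardinals G f q
  have hwin := hstr μ' fun k => by
    simp only [μ']
    rw [modifyCardinals]
    exact hΦθ _ _ _
  have hhead : (fun k => (str.modify G).head k fun q => μ (Fin.castLE k.isLt q)) =
      fun k => str.head k fun q => μ' (Fin.castLE k.isLt q) := by
    funext k
    refine congrArg (str.head k) (funext fun q => modifyCardinals_congr G fun q' hq' => ?_)
    have h1 : q' < k.val + 1 := by omega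
    have h2 : q' < σ.iota := by omega
    simp only [f, extendCardinals, dif_pos h1, dif_pos h2]
    rfl
  rw [hhead]
  let β (k : ℕ) : Ordinal.{u} :=
    if h : k < σ.iota then str.head ⟨k, h⟩ fun q => modifyCardinals G f q else 0
  have hβ : ∀ k : Fin σ.iota, β k = str.head k fun q => μ' (Fin.castLE k.isLt q) := fun k =>
    dif_pos k.isLt
  obtain ⟨X, Y, hX, hY, hsup, hXS⟩ := hwin.exists_sets
  let X' (k : ℕ) : Set M := if h : k < σ.iota then X ⟨k, h⟩ else ∅
  have hX' : ∀ k : Fin σ.iota, X' k = X k := fun k => dif_pos k.isLt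
  have hf : ∀ k : Fin σ.iota, f k = μ k := fun k => dif_pos k.isLt
  have hβθ : ∀ k < σ.iota, β k < θ.ord := fun k hk => by
    simpa only [← hβ] using hwin.head_lt ⟨k, hk⟩
  have hlast : ∀ k < σ.iota, str.lastOrdinal k (fun q _ => modifyCardinals G f q) < θ.ord := by
    intro k hk
    cases k with
    | zero => exact hθ.isRegular.ord_pos
    | succ k => exact hβθ k (by omega)
  have hcard : ∀ k < σ.iota, #(X' k) =
      Φ k (str.lastOrdinal k fun q _ => modifyCardinals G f q) (f k) := by
    intro k hk
    rw [hX' ⟨k, hk⟩, (hX ⟨k, hk⟩).2]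
    simp only [μ']
    rw [modifyCardinals]
  have hfθ : ∀ k < σ.iota, f k < θ := fun k hk => by
    rw [hf ⟨k, hk⟩]
    exact hμ _
  obtain ⟨H, hH, hHσ⟩ := σ.exists_shrink hN hlt hσ (β := β) (X := X') (m := f) hβθ
    (fun k k' hk hk' => by
      have := hwin.head_increasing (show (⟨k, hk.trans hk'⟩ : Fin σ.iota) < ⟨k', hk'⟩ from hk)
      simpa only [← hβ] using this)
    (fun k hk => by
      rw [hX' ⟨k, hk⟩, hβ ⟨k, hk⟩]
      exact (hX ⟨k, hk⟩).1)
    (fun k hk => by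
      -- Homogeneity for a single colour shows that the enlarged cardinal is at least the original
      -- one.
      obtain ⟨H, hH, -⟩ := hΦ k _ (hlast k hk) _ (hfθ k hk) (X' k) PUnit.{u + 1} (hcard k hk).ge
        (by rw [mk_punit, Cardinal.one_le_iff_ne_zero, colourBound, mk_ne_zero_iff]; infer_instance)
        fun _ => PUnit.unit
      exact hH ▸ mk_set_le H)
    (fun k hk C hC => by
      have heq : str.lastOrdinal (k + 1) (fun q _ => modifyCardinals G f q) = β k := rfl
      refine hΦ (k + 1) _ (hlast _ hk) _ (hfθ _ hk) (X' (k + 1)) C (hcard _ hk).ge ?_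
      rwa [heq])
  refine ⟨hwin.head_lt, hwin.tail_lt, hwin.head_increasing, hwin.head_lt_tail, hwin.tail_increasing,
    fun k => H k, Y, fun k => ⟨?_, ?_⟩, hY, hsup, fun a ha => ⟨hXS ⟨fun k hk => ?_, ha.2⟩, ?_⟩⟩
  · refine ((hH k k.isLt).1.trans (hX' k).subset).trans (hX k).1
  · rw [(hH k k.isLt).2, hf]
  · refine ⟨(ha.1 k hk).1, fun j => ?_⟩
    rw [← hX' ⟨k, hk⟩]
    exact (hH k hk).1 ((ha.1 k hk).2 j)
  · exact hHσ a fun k hk => ha.1 k hk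

end Main

end KeislerModels

theorem proposition4p3
    {L : FirstOrder.Language.{v, w}} [Countable L.Symbols] {LS : FirstOrder.Language.{v', w'}} (ι : L →ᴸ LS)
    (lt : L.Relations 2)
    {M : Type u} [LinearOrder M] [L.Structure M] [LS.Structure M] [ι.IsExpansionOn M]
    (hlt : ∀ a b : M, FirstOrder.Language.Structure.RelMap lt ![a, b] ↔ a < b)
    (hSkolem : KeislerModels.HasSkolemFunctions ι M)
    (θ : Cardinal.{u}) (hθ : θ.IsInaccessible) (hM : KeislerModels.IsLike θ M)
    (N : Ordinal.{u} → LS.Substructure M) (hN : KeislerModels.IsElementaryEndChain ι θ N)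
    (r s : ℕ) (hr : 1 ≤ r) (hs : 1 ≤ s) (e e' : ℕ)
    (S : Set (Fin s → Fin r → M))
    (hS : KeislerModels.IsSuperlarge θ (KeislerModels.rank θ N) e S)
    (σ : KeislerModels.SigmaIV LS) (hσ : σ.InRange r s) (hι : σ.iota = e') (he : e ≤ e') :
    ∃ S' ⊆ S, KeislerModels.IsSuperlarge θ (KeislerModels.rank θ N) e' S' ∧
      ∀ a ∈ S', KeislerModels.Holds (σ.sentence (ι.onRelation lt)) a := by
  subst hι
  exact ⟨{a ∈ S | KeislerModels.Holds (σ.sentence (ι.onRelation lt)) a}, fun a ha => ha.1,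
    -- The range condition for the last constant gives `σ.iota ≤ s`.
    (hS.of_le hθ hM hN he (hσ.1 _).1).holds hθ hM hN hlt σ hσ, fun a ha => ha.2⟩
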